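/- For $0\le\alpha<1$ and $\beta>1$ let $T_{\alpha,\beta}\colon[0,1)\to[0,1)$, $T_{\alpha,\beta}(x)=\beta x+\alpha-\lfloor\beta x+\alpha\rfloor$, and for $x\in[0,1)$ and $n\ge1$ put $e_{\alpha,\beta,n}(x)=\lfloor\beta\,T_{\alpha,\beta}^{n-1}(x)+\alpha\rfloor\in\{0,1,\dots,\lfloor\alpha+\beta\rfloor\}$. The $(\alpha,\beta)$-shift is $$\Sigma_{\alpha,\beta}=\overline{\{(e_{\alpha,\beta,n}(x))_{n=1}^\infty : x\in[0,1)\}}\subset\{0,1,\dots,\lfloor\alpha+\beta\rfloor\}^{\mathbb N},$$ the closure being taken in the product of the discrete topologies. Let $\mathcal L(\Sigma)$ be the set of finite words (including the empty word) that appear in some element of a subshift $\Sigma$. We say that $\Sigma$ has the specification property if there is an integer $t\ge0$ such that for all $u,v\in\mathcal L(\Sigma)$ there is $w\in\mathcal L(\Sigma)$ of length $t$ with $uwv\in\mathcal L(\Sigma)$. Theorem 1.1. The set of $(\alpha,\beta)\in[0,1)\times(1,\infty)$ such that $\Sigma_{\alpha,\beta}$ has the specification property is of Hausdorff dimension $2$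 (as a subset of the Euclidean plane). More precisely, with $E_\ell=\{(\alpha,\beta)\in[0,1)\times(1,\infty):\ell\le\alpha+\beta<\ell+1\}$, $$\lim_{\ell\to\infty}\dim_{\mathrm H}\{(\alpha,\beta)\in E_\ell : \Sigma_{\alpha,\beta}\text{ has the specification property}\}=2.$$ -/

import Mathlib

open Set Filter Topology

namespace ABShift

/-- A finite word `w` appears in some element of `X`. Sequences are indexed from `0`. -/
def language {A : Type*} (X : Set (ℕ → A)) : Set (List A) :=
  {w | ∃ ω ∈ X, ∃ m : ℕ, ∀ i : Fin w.length, ω (m + i) = w.get i}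

/-- The specification property: there is a fixed gap length `t` such that any two words of the
language can be joined, inside the language, by a word of length exactly `t`. -/
def HasSpecification {A : Type*} (X : Set (ℕ → A)) : Prop :=
  ∃ t : ℕ, ∀ u ∈ language X, ∀ v ∈ language X,
    ∃ w ∈ language X, w.length = t ∧ u ++ w ++ v ∈ language X

/-- The `(α, β)`-transformation `x ↦ β x + α - ⌊β x + α⌋`; it maps `[0, 1)` into itself. -/
noncomputable def transformation (α β : ℝ) (x : ℝ) : ℝ :=
  β * x + α - ⌊β * x + α⌋

/-- The digits `e_{α,β,n+1}(x) = ⌊β T^n(x) + α⌋` of the `(α, β)`-expansion of `x`. -/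
noncomputable def digit (α β : ℝ) (n : ℕ) (x : ℝ) : ℤ :=
  ⌊β * (transformation α β)^[n] x + α⌋

/-- The codings of the points of `[0, 1)`, as sequences in the full shift over the alphabet
`{0, …, ℓ}` with `ℓ = ⌊α + β⌋`. -/
def codings (α β : ℝ) : Set (ℕ → Fin (⌊α + β⌋₊ + 1)) :=
  {ω | ∃ x ∈ Ico (0 : ℝ) 1, ∀ n, ((ω n : ℕ) : ℤ) = digit α β n x}

/-- The `(α, β)`-shift: the closure of the codings in the full shift over `{0, …, ⌊α + β⌋}`, with
the product of the discrete topologies. -/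
def shift (α β : ℝ) : Set (ℕ → Fin (⌊α + β⌋₊ + 1)) :=
  closure (codings α β)

/-- The parameter space `P = [0, 1) × (1, ∞)`, as a subset of the Euclidean plane;
`p 0` is `α` and `p 1` is `β`. -/
def parameters : Set (EuclideanSpace ℝ (Fin 2)) :=
  {p | p 0 ∈ Ico (0 : ℝ) 1 ∧ p 1 ∈ Ioi (1 : ℝ)}

/-- The pieces `E_ℓ = {(α, β) ∈ P : ℓ ≤ α + β < ℓ + 1}` of the parameter space. -/
def piece (l : ℕ) : Set (EuclideanSpace ℝ (Fin 2)) :=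
  {p | p ∈ parameters ∧ (l : ℝ) ≤ p 0 + p 1 ∧ p 0 + p 1 < l + 1}

/-- The parameters for which the `(α, β)`-shift has the specification property. -/
def specificationParameters : Set (EuclideanSpace ℝ (Fin 2)) :=
  {p | p ∈ parameters ∧ HasSpecification (shift (p 0) (p 1))}

/-- Every point of `[0, 1)` has a coding over the alphabet `{0, …, ⌊α + β⌋}`. -/
theorem exists_coding {α β : ℝ} (hα : α ∈ Ico (0 : ℝ) 1) (hβ : 1 < β) {x : ℝ}
    (hx : x ∈ Ico (0 : ℝ) 1) :
    ∃ ω ∈ codings α β, ∀ n, ((ω n : ℕ) : ℤ) = digit α β n x := by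
  have hT : ∀ n, (transformation α β)^[n] x ∈ Ico (0 : ℝ) 1 := by
    intro n
    induction n with
    | zero => simpa using hx
    | succ k ih =>
      rw [Function.iterate_succ_apply']
      exact ⟨Int.fract_nonneg _, Int.fract_lt_one _⟩
  have h0 : ∀ n, 0 ≤ digit α β n x := fun n =>
    Int.floor_nonneg.2 (add_nonneg (mul_nonneg (by linarith) (hT n).1) hα.1)
  have h1 : ∀ n, (digit α β n x).toNat < ⌊α + β⌋₊ + 1 := by
    intro n
    have h2 : digit α β n x ≤ ⌊α + β⌋ := Int.floor_le_floor (by nlinarith [(hT n).2])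
    have h3 : ((⌊α + β⌋₊ : ℕ) : ℤ) = ⌊α + β⌋ :=
      Int.natCast_floor_eq_floor (by linarith [hα.1])
    have h4 := h0 n
    omega
  have h : ∀ n, (((⟨(digit α β n x).toNat, h1 n⟩ : Fin (⌊α + β⌋₊ + 1)) : ℕ) : ℤ)
      = digit α β n x := fun n => Int.toNat_of_nonneg (h0 n)
  exact ⟨fun n => ⟨_, h1 n⟩, ⟨x, hx, h⟩, h⟩

end ABShift

namespace ABShift

open scoped NNReal

/-! The shift is governed by the orbit of `0` and the left orbit of `1`. If both stay at distance
`δ` from `0` and `1` after time `0`, images of cylinders are intervals of length at least `δ`. For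
`β ≥ 4` such intervals cover `[0, 1)` in a bounded time, and this is specification
(`hasSpecification_of_isExpansion`).

Such parameters are plentiful. Every pair of sequences over `q` digits prescribes the two orbits for
some `(α, β)` with `β ∈ [q + 3, q + 5]` (`exists_parameters`), and pairs first differing at place
`n` give parameters at least `c (q + 5) ^ (-n)` apart (`separation`). Reading the pair as base-`q`
digits of a point of the unit square gives a map with Hölder inverse of exponent `log q / log (q +
5)`. Hence the part in `piece (q + 4)` has dimension at least `2 log q / log (q + 5)`, which tends
to `2`. -/

/-! ### Images of cylinders and covering times -/

/-- `x` is an orbit of the expanding affine map `t ↦ β t + α`, from which at each step the integer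
digit given by `u` is subtracted. -/
def IsExpansion (α β : ℝ) (u : ℕ → ℤ) (x : ℕ → ℝ) : Prop :=
  ∀ n, x (n + 1) = β * x n + α - u n

theorem transformation_mem (α β x : ℝ) : transformation α β x ∈ Ico (0 : ℝ) 1 :=
  ⟨Int.fract_nonneg _, Int.fract_lt_one _⟩

theorem iterate_transformation_mem (α β : ℝ) {x : ℝ} (hx : x ∈ Ico (0 : ℝ) 1) (n : ℕ) :
    (transformation α β)^[n] x ∈ Ico (0 : ℝ) 1 := by
  cases n with
  | zero => exact hx
  | succ k =>
    rw [Function.iterate_succ_apply']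
    exact transformation_mem _ _ _

theorem digit_add (α β : ℝ) (m n : ℕ) (x : ℝ) :
    digit α β (m + n) x = digit α β n ((transformation α β)^[m] x) := by
  rw [digit, digit, ← Function.iterate_add_apply, add_comm m n]

/-- The inverse branch of the transformation with digit `d`. -/
theorem floor_inverse_branch {α β z : ℝ} (hβ : β ≠ 0) (hz : z ∈ Ico (0 : ℝ) 1) (d : ℤ) :
    ⌊β * ((z + d - α) / β) + α⌋ = d ∧ transformation α β ((z + d - α) / β) = z := by
  have h : β * ((z + d - α) / β) + α = z + d := by field_simp; ring
  have hd : ⌊β * ((z + d - α) / β) + α⌋ = d := by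
    rw [h, Int.floor_eq_iff]
    exact ⟨by linarith [hz.1], by linarith [hz.2]⟩
  refine ⟨hd, ?_⟩
  rw [transformation, hd, h]
  ring

theorem inverse_branch_mem {α β a b z : ℝ} (hβ : 0 < β) {d : ℤ}
    (ha : β * a + α - d ≤ z) (hb : z < β * b + α - d) : (z + d - α) / β ∈ Ico a b :=
  ⟨by rw [le_div_iff₀ hβ]; linarith, by rw [div_lt_iff₀ hβ]; linarith⟩

/-- The images of cylinders are half-open intervals whose endpoints lie on the orbits of `0` and of
`1` (the latter from the left); under the hypotheses they are uniformly long. -/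
theorem exists_image_cylinder {α β δ : ℝ} (hβ : 1 < β) (hδ : δ ≤ 1) {u v : ℕ → ℤ} {x y : ℕ → ℝ}
    (hx : IsExpansion α β u x) (hy : IsExpansion α β v y) (hx0 : x 0 = 0) (hy0 : y 0 = 1)
    (hxm : ∀ n, 0 ≤ x n ∧ x n < 1 ∧ x n ≤ 1 - δ) (hym : ∀ n, 0 < y n ∧ y n ≤ 1 ∧ δ ≤ y n)
    {p : ℝ} (hp : p ∈ Ico (0 : ℝ) 1) (n : ℕ) :
    ∃ k m, δ ≤ y m - x k ∧ (transformation α β)^[n] p ∈ Ico (x k) (y m) ∧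
      ∀ z ∈ Ico (x k) (y m), ∃ q ∈ Ico (0 : ℝ) 1,
        (∀ i < n, digit α β i q = digit α β i p) ∧ (transformation α β)^[n] q = z := by
  have hβ0 : 0 < β := by linarith
  induction n with
  | zero =>
    refine ⟨0, 0, by rw [hx0, hy0]; linarith, by rw [hx0, hy0]; exact hp, fun z hz => ?_⟩
    exact ⟨z, by rwa [hx0, hy0] at hz, by simp, rfl⟩
  | succ n ih =>
    obtain ⟨k, m, hlen, hmem, hcyl⟩ := ih
    set t := (transformation α β)^[n] p with ht
    set d : ℤ := ⌊β * t + α⌋ with hd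
    have hTt : (transformation α β)^[n + 1] p = β * t + α - d := by
      rw [Function.iterate_succ_apply', ← ht, transformation]
    have hT01 := iterate_transformation_mem α β hp (n + 1)
    have hd1 : (d : ℝ) ≤ β * t + α := Int.floor_le _
    have hd2 : β * t + α < d + 1 := Int.lt_floor_add_one _
    have hxt : β * x k ≤ β * t := mul_le_mul_of_nonneg_left hmem.1 hβ0.le
    have hyt : β * t < β * y m := mul_lt_mul_of_pos_left hmem.2 hβ0
    -- Any such interval inside the stretched one pulls back through the branch with digit `d`.
    have key : ∀ k' m', δ ≤ y m' - x k' → β * x k + α - d ≤ x k' → y m' ≤ β * y m + α - d →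
        (transformation α β)^[n + 1] p ∈ Ico (x k') (y m') →
        ∃ k m, δ ≤ y m - x k ∧ (transformation α β)^[n + 1] p ∈ Ico (x k) (y m) ∧
          ∀ z ∈ Ico (x k) (y m), ∃ q ∈ Ico (0 : ℝ) 1,
            (∀ i < n + 1, digit α β i q = digit α β i p) ∧
              (transformation α β)^[n + 1] q = z := by
      intro k' m' h1 h2 h3 h4
      refine ⟨k', m', h1, h4, fun z hz => ?_⟩
      have hz01 : z ∈ Ico (0 : ℝ) 1 :=
        ⟨(hxm k').1.trans hz.1, hz.2.trans_le (hym m').2.1⟩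
      obtain ⟨hfl, htr⟩ := floor_inverse_branch (α := α) hβ0.ne' hz01 d
      obtain ⟨q, hq, hqd, hqt⟩ := hcyl _
        (inverse_branch_mem (α := α) hβ0 (h2.trans hz.1) (hz.2.trans_le h3))
      refine ⟨q, hq, fun i hi => ?_, ?_⟩
      · rcases Nat.lt_succ_iff_lt_or_eq.1 hi with hi | rfl
        · exact hqd i hi
        · rw [digit, hqt, hfl, digit]
      · rw [Function.iterate_succ_apply', hqt, htr]
    -- An endpoint that is not cut off shares the digit `d` of the interior point `t`, so its image
    -- is the next orbit point.
    have hux : (d : ℝ) ≤ β * x k + α → u k = d := by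
      intro h
      have h1 := hx k
      have h2 := hxm (k + 1)
      have h3 : ((u k : ℤ) : ℝ) < (d + 1 : ℤ) := by push_cast; linarith
      have h4 : (d : ℝ) < (u k + 1 : ℤ) := by push_cast; linarith
      have h5 := Int.cast_lt.1 h3
      have h6 := Int.cast_lt.1 h4
      omega
    have hvy : β * y m + α ≤ d + 1 → v m = d := by
      intro h
      have h1 := hy m
      have h2 := hym (m + 1)
      have h3 : ((v m : ℤ) : ℝ) < (d + 1 : ℤ) := by push_cast; linarith
      have h4 : (d : ℝ) < (v m + 1 : ℤ) := by push_cast; linarith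
      have h5 := Int.cast_lt.1 h3
      have h6 := Int.cast_lt.1 h4
      omega
    have hgrow : y m - x k ≤ β * (y m - x k) := by
      have h1 : 0 ≤ y m - x k := by linarith [hmem.1, hmem.2]
      nlinarith
    -- Either end of the stretched interval may be cut by `d` or `d + 1`. A cut end restarts its
    -- orbit at index `0`; the distance `δ` of the other orbit from this end keeps the length.
    rcases le_or_gt (d : ℝ) (β * x k + α) with hA | hA <;>
    rcases le_or_gt (β * y m + α) (d + 1) with hB | hB
    · have h1 := hx k
      have h2 := hy m
      rw [hux hA] at h1
      rw [hvy hB] at h2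
      exact key (k + 1) (m + 1) (by linarith) h1.ge h2.le
        ⟨by linarith, by linarith⟩
    · have h1 := hx k
      rw [hux hA] at h1
      exact key (k + 1) 0 (by linarith [(hxm (k + 1)).2.2]) h1.ge (by linarith)
        ⟨by linarith, by linarith [hT01.2]⟩
    · have h2 := hy m
      rw [hvy hB] at h2
      exact key 0 (m + 1) (by linarith [(hym (m + 1)).2.2]) (by linarith) h2.le
        ⟨by linarith [hT01.1], by linarith⟩
    · exact key 0 0 (by linarith) (by linarith) (by linarith)
        ⟨by linarith [hT01.1], by linarith [hT01.2]⟩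

/-- An interval of length at least `2⁻ᵗ` covers `[0, 1)` after `t + 1` steps. -/
theorem exists_iterate_eq {α β : ℝ} (hα : α ∈ Ico (0 : ℝ) 1) (hβ : 4 ≤ β) (t : ℕ) :
    ∀ a b : ℝ, 0 ≤ a → b ≤ 1 → 1 ≤ (b - a) * 2 ^ t → ∀ z ∈ Ico (0 : ℝ) 1,
      ∃ p ∈ Ico a b, (transformation α β)^[t + 1] p = z := by
  have hβ0 : 0 < β := by linarith
  obtain ⟨hα0, hα1⟩ := hα
  induction t with
  | zero =>
    intro a b ha hb hab z hz
    obtain rfl : a = 0 := by rw [pow_zero] at hab; linarith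
    obtain rfl : b = 1 := by rw [pow_zero] at hab; linarith
    -- Digit `1` is a full branch, since `α < 1` and `β ≥ 2`.
    refine ⟨_, inverse_branch_mem (d := 1) (α := α) (z := z) hβ0 ?_ ?_, ?_⟩
    · push_cast; linarith [hz.1]
    · push_cast; linarith [hz.2]
    · exact (floor_inverse_branch hβ0.ne' hz 1).2
  | succ t ih =>
    intro a b ha hb hab z hz
    have h2t : (0 : ℝ) < 2 ^ t := by positivity
    have h1t : (1 : ℝ) ≤ 2 ^ t := one_le_pow₀ (by norm_num)
    have hpos : 0 < b - a := by
      by_contra h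
      have : (b - a) * 2 ^ (t + 1) ≤ 0 :=
        mul_nonpos_of_nonpos_of_nonneg (not_lt.1 h) (by positivity)
      linarith
    have key : ∀ (d : ℤ) (a' b' : ℝ), 0 ≤ a' → b' ≤ 1 → β * a + α - d ≤ a' →
        b' ≤ β * b + α - d → 1 ≤ (b' - a') * 2 ^ t →
        ∃ p ∈ Ico a b, (transformation α β)^[t + 1 + 1] p = z := by
      intro d a' b' h1 h2 h3 h4 h5
      obtain ⟨p, hp, hpz⟩ := ih a' b' h1 h2 h5 z hz
      refine ⟨_, inverse_branch_mem (α := α) hβ0 (h3.trans hp.1) (hp.2.trans_le h4), ?_⟩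
      rw [Function.iterate_succ_apply,
        (floor_inverse_branch hβ0.ne' ⟨h1.trans hp.1, hp.2.trans_le h2⟩ d).2, hpz]
    have hlong : ∀ L, 2 * (b - a) ≤ L → 1 ≤ L * 2 ^ t := fun L hL => by
      rw [pow_succ] at hab
      nlinarith
    have h4 : 4 * (b - a) ≤ β * (b - a) := mul_le_mul_of_nonneg_right hβ hpos.le
    set d : ℤ := ⌊β * a + α⌋ with hd
    have hd1 : (d : ℝ) ≤ β * a + α := Int.floor_le _
    have hd2 : β * a + α < d + 1 := Int.lt_floor_add_one _
    -- The stretched interval is at least four times as long. Unless it contains a full branch, at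
    -- most one integer cuts it, and the longer piece is still at least twice as long as the
    -- original.
    rcases le_or_gt (β * b + α - d) 1 with hB | hB
    · exact key d _ _ (by linarith) hB le_rfl le_rfl (hlong _ (by linarith))
    rcases le_or_gt 2 (β * b + α - d) with hB2 | hB2
    · exact key (d + 1) 0 1 le_rfl le_rfl (by push_cast; linarith) (by push_cast; linarith)
        (by linarith)
    rcases le_or_gt (2 * (b - a)) (1 - (β * a + α - d)) with hL | hL
    · exact key d _ 1 (by linarith) le_rfl le_rfl hB.le (hlong _ hL)
    · exact key (d + 1) 0 (β * b + α - d - 1) le_rfl (by linarith) (by push_cast; linarith)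
        (by push_cast; linarith) (hlong _ (by linarith))

/-! ### Words of the shift and specification -/

theorem mem_language_iff {A : Type*} {X : Set (ℕ → A)} {w : List A} :
    w ∈ language X ↔ ∃ ω ∈ X, ∃ m, w = (List.range' m w.length).map ω := by
  refine exists_congr fun ω => and_congr_right fun _ => exists_congr fun m => ?_
  constructor
  · intro h
    refine List.ext_getElem (by simp) fun i h1 h2 => ?_
    simpa using (h ⟨i, h1⟩).symm
  · intro h i
    have : w[i.1] = ((List.range' m w.length).map ω)[i.1]'(by simp) := by
      congr 1
    simpa using this.symm

theorem map_range'_mem_language {A : Type*} {X : Set (ℕ → A)} {ω : ℕ → A} (hω : ω ∈ X)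
    (m n : ℕ) : (List.range' m n).map ω ∈ language X :=
  mem_language_iff.2 ⟨ω, hω, m, by simp⟩

/-- Words of the closure already occur in the set itself. -/
theorem language_closure {A : Type*} [TopologicalSpace A] [DiscreteTopology A]
    (X : Set (ℕ → A)) : language (closure X) = language X := by
  refine Subset.antisymm ?_ fun w ⟨ω, hω, h⟩ => ⟨ω, subset_closure hω, h⟩
  rintro w ⟨ω, hω, m, h⟩
  have hopen : IsOpen (⋂ i : Fin w.length, {ω' : ℕ → A | ω' (m + i) = w.get i}) :=
    isOpen_iInter_of_finite fun i =>
      (isOpen_discrete {w.get i}).preimage (continuous_apply (A := fun _ : ℕ => A) (m + i.1))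
  obtain ⟨ω', h1, h2⟩ := mem_closure_iff.1 hω _ hopen (mem_iInter.2 h)
  exact ⟨ω', h2, m, mem_iInter.1 h1⟩

/-- Every word of the language is an initial block of digits of some point. -/
theorem exists_point_of_mem_language {α β : ℝ} {w : List (Fin (⌊α + β⌋₊ + 1))}
    (hw : w ∈ language (shift α β)) :
    ∃ p ∈ Ico (0 : ℝ) 1, ∀ i (hi : i < w.length), ((w[i] : ℕ) : ℤ) = digit α β i p := by
  rw [shift, language_closure] at hw
  obtain ⟨ω, ⟨x, hx, hω⟩, m, h⟩ := hw
  refine ⟨_, iterate_transformation_mem α β hx m, fun i hi => ?_⟩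
  rw [← digit_add, ← hω, h ⟨i, hi⟩]
  rfl

/-- If the orbit of `0` stays away from `1` and the left orbit of `1` stays away from `0`, the
`(α, β)`-shift has the specification property. -/
theorem hasSpecification_of_isExpansion {α β δ : ℝ} (hα : α ∈ Ico (0 : ℝ) 1) (hβ : 4 ≤ β)
    (hδ0 : 0 < δ) (hδ : δ ≤ 1) {u v : ℕ → ℤ} {x y : ℕ → ℝ}
    (hx : IsExpansion α β u x) (hy : IsExpansion α β v y) (hx0 : x 0 = 0) (hy0 : y 0 = 1)
    (hxm : ∀ n, x (n + 1) ∈ Icc δ (1 - δ)) (hym : ∀ n, y (n + 1) ∈ Icc δ (1 - δ)) :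
    HasSpecification (shift α β) := by
  obtain ⟨t, ht⟩ : ∃ t : ℕ, 1 ≤ δ * 2 ^ t := by
    obtain ⟨t, ht⟩ := pow_unbounded_of_one_lt (1 / δ) (one_lt_two (α := ℝ))
    exact ⟨t, by rw [div_lt_iff₀ hδ0] at ht; linarith⟩
  have hxm' : ∀ n, 0 ≤ x n ∧ x n < 1 ∧ x n ≤ 1 - δ := by
    rintro (_ | n)
    · rw [hx0]; exact ⟨le_rfl, one_pos, by linarith⟩
    · have := hxm n; exact ⟨by linarith [this.1], by linarith [this.2], this.2⟩
  have hym' : ∀ n, 0 < y n ∧ y n ≤ 1 ∧ δ ≤ y n := by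
    rintro (_ | n)
    · rw [hy0]; exact ⟨one_pos, le_rfl, hδ⟩
    · have := hym n; exact ⟨by linarith [this.1], by linarith [this.2], this.1⟩
  refine ⟨t + 1, fun a ha b hb => ?_⟩
  obtain ⟨p, hp, hpa⟩ := exists_point_of_mem_language ha
  obtain ⟨r, hr, hrb⟩ := exists_point_of_mem_language hb
  obtain ⟨k, m, hlen, -, hcyl⟩ := exists_image_cylinder (β := β) (by linarith) hδ hx hy hx0 hy0 hxm' hym' hp
    a.length
  obtain ⟨s, hs, hsr⟩ := exists_iterate_eq hα hβ t (x k) (y m) (hxm' k).1 (hym' m).2.1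
    (ht.trans (mul_le_mul_of_nonneg_right hlen (by positivity))) r hr
  obtain ⟨q, hq, hqd, hqs⟩ := hcyl s hs
  obtain ⟨ω, hω, hωq⟩ := exists_coding (β := β) hα (by linarith) hq
  have hω' : ω ∈ shift α β := subset_closure hω
  have ha' : a = (List.range' 0 a.length).map ω := by
    refine List.ext_getElem (by simp) fun i h1 h2 => ?_
    have h := (hpa i h1).trans ((hqd i h1).symm.trans (hωq i).symm)
    ext
    simpa using h
  have hb' : b = (List.range' (a.length + (t + 1)) b.length).map ω := by
    refine List.ext_getElem (by simp) fun i h1 h2 => ?_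
    have h := hωq (a.length + (t + 1) + i)
    rw [digit_add, add_comm a.length, Function.iterate_add_apply, hqs, hsr, ← hrb i h1] at h
    ext
    simpa [add_comm a.length] using h.symm
  refine ⟨(List.range' a.length (t + 1)).map ω, map_range'_mem_language hω' _ _, by simp, ?_⟩
  have h := map_range'_mem_language hω' 0 (a.length + (t + 1) + b.length)
  rw [← List.range'_append_1, ← List.range'_append_1, List.map_append, List.map_append] at h
  simp only [zero_add] at h
  rwa [← hb', ← ha'] at h

/-! ### Realising prescribed digits -/

/-- The digit sequence with first digit `d` and further digits `a n + 2`. -/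
def shiftedDigits {q : ℕ} (d : ℤ) (a : ℕ → Fin q) : ℕ → ℤ
  | 0 => d
  | n + 1 => (a n : ℕ) + 2

/-- The value `∑ (a k + 2) β ^ (-k-1)`. -/
noncomputable def seriesValue {q : ℕ} (a : ℕ → Fin q) (β : ℝ) : ℝ :=
  ∑' k, ((a k : ℕ) + 2 : ℝ) * (β⁻¹) ^ (k + 1)

section

variable {q : ℕ} (a : ℕ → Fin q) {β : ℝ}

theorem hasSum_inv_pow_succ (hβ : 1 < β) : HasSum (fun k : ℕ => β⁻¹ ^ (k + 1)) (1 / (β - 1)) := by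
  have h := (hasSum_geometric_of_lt_one (inv_nonneg.2 (by linarith))
    (inv_lt_one_of_one_lt₀ hβ)).mul_left β⁻¹
  have h0 : β ≠ 0 := by positivity
  have h1 : β - 1 ≠ 0 := by linarith
  have e : β⁻¹ * (1 - β⁻¹)⁻¹ = 1 / (β - 1) := by
    rw [← mul_inv, mul_sub, mul_inv_cancel₀ h0, mul_one, one_div]
  rw [e] at h
  simpa only [pow_succ'] using h

theorem term_le (hβ : 1 < β) (k : ℕ) :
    ((a k : ℕ) + 2 : ℝ) * β⁻¹ ^ (k + 1) ≤ (q + 1) * β⁻¹ ^ (k + 1) := by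
  have h1 : ((a k : ℕ) : ℝ) + 1 ≤ q := by exact_mod_cast (a k).2
  have h2 : 0 ≤ β⁻¹ ^ (k + 1) := by positivity
  exact mul_le_mul_of_nonneg_right (by linarith) h2

theorem summable_term (hβ : 1 < β) :
    Summable fun k => ((a k : ℕ) + 2 : ℝ) * β⁻¹ ^ (k + 1) :=
  .of_nonneg_of_le (fun k => by positivity) (term_le a hβ)
    ((hasSum_inv_pow_succ hβ).summable.mul_left _)

theorem seriesValue_mem (hβ : 1 < β) :
    seriesValue a β ∈ Icc (2 / (β - 1)) ((q + 1) / (β - 1)) := by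
  have h := hasSum_inv_pow_succ hβ
  constructor
  · rw [div_eq_mul_one_div]
    refine hasSum_le (fun k => ?_) (h.mul_left 2) (summable_term a hβ).hasSum
    exact mul_le_mul_of_nonneg_right (by linarith [Nat.cast_nonneg (α := ℝ) (a k : ℕ)])
      (by positivity)
  · rw [div_eq_mul_one_div]
    exact hasSum_le (term_le a hβ) (summable_term a hβ).hasSum (h.mul_left _)

/-- Multiplication by `β` shifts the digits; subtracting `α / (β - 1)` turns this into the recursion
of `IsExpansion`. -/
theorem mul_seriesValue (hβ : 1 < β) :
    β * seriesValue a β = (a 0 : ℕ) + 2 + seriesValue (fun k => a (k + 1)) β := by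
  have h0 : β ≠ 0 := by positivity
  rw [seriesValue, (summable_term a hβ).tsum_eq_zero_add, mul_add, seriesValue, ← tsum_mul_left]
  congr 1
  · rw [zero_add, pow_one, mul_left_comm, mul_inv_cancel₀ h0, mul_one]
  · refine tsum_congr fun k => ?_
    rw [pow_succ' _ (k + 1)]
    field_simp

theorem continuousOn_seriesValue {c : ℝ} (hc : 1 < c) :
    ContinuousOn (seriesValue a) (Ici c) := by
  have hne : ∀ x ∈ Ici c, x ≠ 0 := fun x hx => by
    have : c ≤ x := hx
    exact (by linarith : 0 < x).ne'
  refine continuousOn_tsum (fun k => ?_)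
    ((hasSum_inv_pow_succ hc).summable.mul_left ((q : ℝ) + 1)) fun k x hx => ?_
  · exact continuousOn_const.mul ((continuousOn_id.inv₀ hne).pow _)
  · have hx' : c ≤ x := hx
    have h1 : 1 < x := by linarith
    rw [Real.norm_of_nonneg (by positivity)]
    refine (term_le a h1 k).trans ?_
    gcongr

end

/-- Every pair of digit sequences is realised by the expansions of `0` and `1` for some
parameters. -/
theorem exists_parameters {q : ℕ} (hq : 1 ≤ q) (a b : ℕ → Fin q) :
    ∃ (α β : ℝ) (x y : ℕ → ℝ), α ∈ Ico (0 : ℝ) 1 ∧ β ∈ Icc ((q : ℝ) + 3) (q + 5) ∧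
      IsExpansion α β (shiftedDigits 0 a) x ∧ IsExpansion α β (shiftedDigits (q + 4) b) y ∧
      x 0 = 0 ∧ y 0 = 1 ∧ (∀ n, x (n + 1) ∈ Icc (1 / (q + 4 : ℝ)) (1 - 1 / (q + 4))) ∧
      ∀ n, y (n + 1) ∈ Icc (1 / (q + 4 : ℝ)) (1 - 1 / (q + 4)) := by
  have hq' : (1 : ℝ) ≤ q := by exact_mod_cast hq
  have hbd : ∀ β : ℝ, q + 3 ≤ β → |seriesValue b β - seriesValue a β| ≤ 1 := by
    intro β hβ
    have h1 := seriesValue_mem a (β := β) (by linarith)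
    have h2 := seriesValue_mem b (β := β) (by linarith)
    have h3 : (q + 1) / (β - 1) - 2 / (β - 1) ≤ 1 := by
      rw [← sub_div, div_le_one (by linarith)]
      linarith
    rw [abs_le]
    exact ⟨by linarith [h1.2, h2.1], by linarith [h1.1, h2.2]⟩
  -- Equating the first orbit points with their series gives `αβ / (β - 1) = S_a(β)` and `β = q + 4
  -- + S_b(β) - S_a(β)`, where `S` is `seriesValue`.
  obtain ⟨β, hβ, hfix⟩ : ∃ β ∈ Icc ((q : ℝ) + 3) (q + 5),
      (q + 4 + (seriesValue b β - seriesValue a β)) - β = 0 := by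
    have hsub : Icc ((q : ℝ) + 3) (q + 5) ⊆ Ici ((q : ℝ) + 3) := Icc_subset_Ici_self
    have hcont : ContinuousOn (fun β => (q + 4 + (seriesValue b β - seriesValue a β)) - β)
        (Icc ((q : ℝ) + 3) (q + 5)) :=
      (continuousOn_const.add
        (((continuousOn_seriesValue b (by linarith)).mono hsub).sub
          ((continuousOn_seriesValue a (by linarith)).mono hsub))).sub continuousOn_id
    refine intermediate_value_Icc' (by linarith) hcont ⟨?_, ?_⟩
    · linarith [(abs_le.1 (hbd (q + 5) (by linarith))).2]
    · linarith [(abs_le.1 (hbd (q + 3) le_rfl)).1]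
  have hβ1 : 1 < β := by linarith [hβ.1]
  have hβ0 : 0 < β := by linarith
  have hβ2 : 0 < β - 1 := by linarith
  have hSa := seriesValue_mem a hβ1
  set α : ℝ := (β - 1) * seriesValue a β / β with hαdef
  have hαS : α * β / (β - 1) = seriesValue a β := by
    rw [hαdef]; field_simp
  have hα0 : 0 ≤ α := by
    have : 0 ≤ seriesValue a β := le_trans (by positivity) hSa.1
    positivity
  have hα1 : α < 1 := by
    rw [hαdef, div_lt_one hβ0]
    have := (le_div_iff₀ hβ2).1 hSa.2
    linarith [hβ.1]
  -- The digit offset `2`, with `α < 1`, keeps the orbit off `0`; the largest digit `q + 1`, with `β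
  -- ≥ q + 3`, keeps it off `1`.
  have hmem : ∀ c : ℕ → Fin q,
      seriesValue c β - α / (β - 1) ∈ Icc (1 / (q + 4 : ℝ)) (1 - 1 / (q + 4)) := by
    intro c
    have h := seriesValue_mem c hβ1
    constructor
    · have h1 : 1 / (q + 4 : ℝ) ≤ 2 / (β - 1) - α / (β - 1) := by
        rw [← sub_div, div_le_div_iff₀ (by linarith) hβ2]
        nlinarith [hβ.2]
      linarith [h.1]
    · have h1 : (q + 1) / (β - 1) ≤ 1 - 1 / (q + 4) := by
        rw [one_sub_div (by linarith), div_le_div_iff₀ hβ2 (by linarith)]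
        nlinarith [hβ.1]
      have h2 : 0 ≤ α / (β - 1) := by positivity
      linarith [h.2]
  have hrec : ∀ c : ℕ → Fin q, seriesValue (fun k => c (k + 1)) β - α / (β - 1) =
      β * (seriesValue c β - α / (β - 1)) + α - ((c 0 : ℕ) + 2 : ℝ) := by
    intro c
    have h := mul_seriesValue c hβ1
    have h2 : β * (α / (β - 1)) = α + α / (β - 1) := by field_simp; ring
    linarith
  have hαβ : α * β / (β - 1) = α + α / (β - 1) := by field_simp; ring
  refine ⟨α, β, fun n => n.casesOn 0 fun n => seriesValue (fun k => a (k + n)) β - α / (β - 1),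
    fun n => n.casesOn 1 fun n => seriesValue (fun k => b (k + n)) β - α / (β - 1),
    ⟨hα0, hα1⟩, hβ, ?_, ?_, rfl, rfl, fun n => hmem _, fun n => hmem _⟩
  · rintro (_ | n)
    · change seriesValue a β - α / (β - 1) = β * 0 + α - ((0 : ℤ) : ℝ)
      push_cast
      linarith
    · have h := hrec fun k => a (k + n)
      simp only [shiftedDigits]
      push_cast
      rw [zero_add] at h
      rw [← h]
      simp only [add_right_comm, add_assoc]
  · rintro (_ | n)
    · change seriesValue b β - α / (β - 1) = β * 1 + α - ((q + 4 : ℤ) : ℝ)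
      push_cast
      linarith
    · have h := hrec fun k => b (k + n)
      simp only [shiftedDigits]
      push_cast
      rw [zero_add] at h
      rw [← h]
      simp only [add_right_comm, add_assoc]

/-! ### Separation of parameters -/

/-- Parameters whose expansions have the same starting point, stay away from `0` and `1`, and
first differ at the `n`-th digit are separated by a multiple of `B ^ (-n-1)`. -/
theorem separation {α β α' β' δ B : ℝ} (hB : 2 ≤ B) (hβ : β ∈ Icc 0 B) (hδ : 0 < δ)
    {u u' : ℕ → ℤ} {x x' : ℕ → ℝ} (hx : IsExpansion α β u x) (hx' : IsExpansion α' β' u' x')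
    (h0 : x 0 = x' 0) (h0' : |x' 0| ≤ 1)
    (hm : ∀ n, x (n + 1) ∈ Icc δ (1 - δ)) (hm' : ∀ n, x' (n + 1) ∈ Icc δ (1 - δ))
    {n : ℕ} (hu : ∀ k < n, u k = u' k) (hn : u n ≠ u' n) :
    2 * δ ≤ (|α - α'| + |β - β'|) * B ^ (n + 1) := by
  set s := |α - α'| + |β - β'| with hs
  have hs0 : 0 ≤ s := by positivity
  have hx1 : ∀ k, |x' k| ≤ 1 := by
    rintro (_ | k)
    · exact h0'
    · have := hm' k
      rw [abs_le]
      exact ⟨by linarith [this.1], by linarith [this.2]⟩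
  -- The `-1` absorbs the error `s` added at each step, as `B ≥ 2`.
  have hstep : ∀ k, |x k - x' k| ≤ s * (B ^ k - 1) →
      |(β * x k + α) - (β' * x' k + α')| ≤ s * (B ^ (k + 1) - 1) := by
    intro k hk
    have e : (β * x k + α) - (β' * x' k + α') = β * (x k - x' k) + ((β - β') * x' k + (α - α')) := by
      ring
    have h1 : |β * (x k - x' k)| ≤ B * (s * (B ^ k - 1)) := by
      rw [abs_mul, abs_of_nonneg hβ.1]
      exact mul_le_mul hβ.2 hk (abs_nonneg _) (by linarith)
    have h2 : |(β - β') * x' k| ≤ |β - β'| := by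
      rw [abs_mul]
      exact mul_le_of_le_one_right (abs_nonneg _) (hx1 k)
    have h3 := abs_add_le (β * (x k - x' k)) ((β - β') * x' k + (α - α'))
    have h4 := abs_add_le ((β - β') * x' k) (α - α')
    rw [e, pow_succ]
    nlinarith
  have hd : ∀ k ≤ n, |x k - x' k| ≤ s * (B ^ k - 1) := by
    intro k
    induction k with
    | zero => intro; simp [h0]
    | succ k ih =>
      intro hk
      have h := hstep k (ih (by omega))
      rw [hx k, hx' k, hu k (by omega)]
      convert h using 2
      ring
  have h := hstep n (hd n le_rfl)
  have hu1 : (1 : ℝ) ≤ |(u n : ℝ) - u' n| := by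
    exact_mod_cast Int.one_le_abs (sub_ne_zero.2 hn)
  have h1 := hx n
  have h2 := hx' n
  -- The digits differ by at least `1`, the next points by at most `1 - 2δ`, so the values before
  -- subtracting digits differ by at least `2δ`.
  have h3 : |x (n + 1) - x' (n + 1)| ≤ 1 - 2 * δ := by
    have h4 := hm n
    have h5 := hm' n
    rw [abs_le]
    exact ⟨by linarith [h4.1, h5.2], by linarith [h4.2, h5.1]⟩
  have h6 : (u n : ℝ) - u' n = ((β * x n + α) - (β' * x' n + α')) - (x (n + 1) - x' (n + 1)) := by
    linarith
  have h7 := abs_sub ((β * x n + α) - (β' * x' n + α')) (x (n + 1) - x' (n + 1))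
  rw [← h6] at h7
  nlinarith

/-! ### Hausdorff dimension -/

/-- A map whose inverse is Hölder continuous with exponent `r` decreases the Hausdorff dimension at
most by the factor `r`. -/
theorem dimH_le_of_dist_le {X Y : Type*} [MetricSpace X] [MetricSpace Y] {s : Set X} {P : X → Y}
    {C r : ℝ≥0} (hr : 0 < r)
    (h : ∀ x ∈ s, ∀ y ∈ s, dist x y ≤ C * dist (P x) (P y) ^ (r : ℝ)) :
    dimH s ≤ dimH (P '' s) / r := by
  rcases s.eq_empty_or_nonempty with rfl | ⟨x₀, -⟩
  · simp
  have : Nonempty X := ⟨x₀⟩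
  have hr' : (r : ℝ) ≠ 0 := by exact_mod_cast hr.ne'
  have hinj : InjOn P s := fun x hx y hy hxy => by
    have := h x hx y hy
    rw [hxy, dist_self, Real.zero_rpow hr', mul_zero] at this
    exact dist_le_zero.1 this
  have hleft := hinj.leftInvOn_invFunOn
  have hH : HolderOnWith C r (Function.invFunOn P s) (P '' s) := by
    rintro _ ⟨x, hx, rfl⟩ _ ⟨y, hy, rfl⟩
    rw [hleft hx, hleft hy, edist_dist, edist_dist,
      ENNReal.ofReal_rpow_of_nonneg dist_nonneg r.coe_nonneg, ← ENNReal.ofReal_coe_nnreal (p := C),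
      ← ENNReal.ofReal_mul C.coe_nonneg]
    exact ENNReal.ofReal_le_ofReal (h x hx y hy)
  have := hH.dimH_image_le hr
  rwa [hleft.image_image] at this

theorem shiftedDigits_succ_eq_iff {q : ℕ} {d : ℤ} {a a' : ℕ → Fin q} {n : ℕ} :
    shiftedDigits d a (n + 1) = shiftedDigits d a' (n + 1) ↔ a n = a' n := by
  simp [shiftedDigits, Fin.ext_iff]

theorem separation_shiftedDigits {q n : ℕ} {α β α' β' : ℝ} {d : ℤ} {a a' : ℕ → Fin q}
    {x x' : ℕ → ℝ} (hβ : β ∈ Icc ((q : ℝ) + 3) (q + 5))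
    (hx : IsExpansion α β (shiftedDigits d a) x) (hx' : IsExpansion α' β' (shiftedDigits d a') x')
    (h0 : x 0 = x' 0) (h0' : |x' 0| ≤ 1)
    (hm : ∀ n, x (n + 1) ∈ Icc (1 / (q + 4 : ℝ)) (1 - 1 / (q + 4)))
    (hm' : ∀ n, x' (n + 1) ∈ Icc (1 / (q + 4 : ℝ)) (1 - 1 / (q + 4)))
    (ha : ∀ k < n, a k = a' k) (hn : a n ≠ a' n) :
    2 * (1 / (q + 4 : ℝ)) ≤ (|α - α'| + |β - β'|) * (q + 5 : ℝ) ^ (n + 2) := by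
  have hq : (0 : ℝ) ≤ q := q.cast_nonneg
  refine separation (B := q + 5) (by linarith) ⟨by linarith [hβ.1], hβ.2⟩ (by positivity) hx hx' h0
    h0' hm hm' (n := n + 1) ?_ (mt shiftedDigits_succ_eq_iff.1 hn)
  rintro (_ | k) hk
  · rfl
  · exact shiftedDigits_succ_eq_iff.2 (ha k (by omega))

theorem le_dimH_piece {q : ℕ} (hq : 2 ≤ q) :
    ENNReal.ofReal (2 * (Real.log q / Real.log (q + 5))) ≤
      dimH (specificationParameters ∩ piece (q + 4)) := by
  have hq2 : (2 : ℝ) ≤ q := by exact_mod_cast hq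
  have : NeZero q := ⟨by omega⟩
  choose A B x y hA hB hx hy hx0 hy0 hxm hym using exists_parameters (q := q) (by omega)
  let P : ℝ × ℝ → EuclideanSpace ℝ (Fin 2) := fun z =>
    !₂[A (Real.digits z.1 q) (Real.digits z.2 q), B (Real.digits z.1 q) (Real.digits z.2 q)]
  set S : Set (ℝ × ℝ) := Ico (0 : ℝ) 1 ×ˢ Ico (0 : ℝ) 1 with hS
  have hlogq : 0 < Real.log q := Real.log_pos (by linarith)
  have hlogB : 0 < Real.log (q + 5) := Real.log_pos (by linarith)
  let r : ℝ≥0 := ⟨Real.log q / Real.log (q + 5), by positivity⟩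
  have hr : 0 < r := by
    rw [← NNReal.coe_pos]
    change 0 < Real.log q / Real.log (q + 5)
    positivity
  have hBr : ((q : ℝ) + 5) ^ (r : ℝ) = q := by
    change ((q : ℝ) + 5) ^ (Real.log q / Real.log (q + 5)) = q
    rw [Real.rpow_def_of_pos (by linarith), mul_div_cancel₀ _ hlogB.ne', Real.exp_log (by linarith)]
  -- Here `q + 4` is `1 / δ`, and the square comes from the exponent `n + 2` in the separation
  -- bound: one for the fixed first digit, one for the step at which digits differ.
  let C : ℝ≥0 := ⟨(((q : ℝ) + 4) * (q + 5) ^ 2) ^ (r : ℝ), by positivity⟩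
  have hdist : ∀ z ∈ S, ∀ z' ∈ S, dist z z' ≤ C * dist (P z) (P z') ^ (r : ℝ) := by
    intro z hz z' hz'
    set a := Real.digits z.1 q with ha
    set b := Real.digits z.2 q with hb
    set a' := Real.digits z'.1 q with ha'
    set b' := Real.digits z'.2 q with hb'
    have hz1 : Real.ofDigits a = z.1 := Real.ofDigits_digits (by omega) hz.1
    have hz2 : Real.ofDigits b = z.2 := Real.ofDigits_digits (by omega) hz.2
    have hz1' : Real.ofDigits a' = z'.1 := Real.ofDigits_digits (by omega) hz'.1
    have hz2' : Real.ofDigits b' = z'.2 := Real.ofDigits_digits (by omega) hz'.2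
    by_cases hne : ∃ n, a n ≠ a' n ∨ b n ≠ b' n
    · classical
      set n := Nat.find hne with hn
      have hlt : ∀ k < n, a k = a' k ∧ b k = b' k := fun k hk => by
        simpa [not_or] using Nat.find_min hne hk
      have hzz : dist z z' ≤ ((q : ℝ) ^ n)⁻¹ := by
        rw [Prod.dist_eq, Real.dist_eq, Real.dist_eq, ← hz1, ← hz2, ← hz1', ← hz2']
        exact max_le (Real.abs_ofDigits_sub_ofDigits_le fun k hk => (hlt k hk).1)
          (Real.abs_ofDigits_sub_ofDigits_le fun k hk => (hlt k hk).2)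
      have hsep : 2 * (1 / (q + 4 : ℝ)) ≤
          (|A a b - A a' b'| + |B a b - B a' b'|) * (q + 5 : ℝ) ^ (n + 2) := by
        rcases Nat.find_spec hne with h | h
        · exact separation_shiftedDigits (hB a b) (hx a b) (hx a' b') (by rw [hx0, hx0])
            (by simp [hx0]) (hxm a b) (hxm a' b') (fun k hk => (hlt k hk).1) h
        · exact separation_shiftedDigits (hB a b) (hy a b) (hy a' b') (by rw [hy0, hy0])
            (by simp [hy0]) (hym a b) (hym a' b') (fun k hk => (hlt k hk).2) h
      have hPA : |A a b - A a' b'| ≤ dist (P z) (P z') := by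
        have := PiLp.norm_apply_le (P z - P z') 0
        rw [dist_eq_norm]
        simpa [P] using this
      have hPB : |B a b - B a' b'| ≤ dist (P z) (P z') := by
        have := PiLp.norm_apply_le (P z - P z') 1
        rw [dist_eq_norm]
        simpa [P] using this
      have hd : (((q : ℝ) + 5) ^ n)⁻¹ ≤ ((q + 4) * (q + 5) ^ 2) * dist (P z) (P z') := by
        have h1 : 2 * (1 / (q + 4 : ℝ)) ≤ (2 * dist (P z) (P z')) * (q + 5 : ℝ) ^ (n + 2) :=
          hsep.trans (mul_le_mul_of_nonneg_right (by linarith) (by positivity))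
        have h2 : (1 : ℝ) / (q + 4) ≤ dist (P z) (P z') * (q + 5 : ℝ) ^ (n + 2) := by linarith
        rw [div_le_iff₀ (by positivity)] at h2
        rw [inv_le_iff_one_le_mul₀ (by positivity)]
        refine h2.trans (le_of_eq ?_)
        ring
      calc dist z z' ≤ ((q : ℝ) ^ n)⁻¹ := hzz
        _ = ((((q : ℝ) + 5) ^ n)⁻¹) ^ (r : ℝ) := by
          rw [Real.inv_rpow (by positivity), ← Real.rpow_pow_comm (by positivity), hBr]
        _ ≤ (((q + 4) * (q + 5) ^ 2) * dist (P z) (P z')) ^ (r : ℝ) :=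
          Real.rpow_le_rpow (by positivity) hd r.coe_nonneg
        _ = C * dist (P z) (P z') ^ (r : ℝ) :=
          Real.mul_rpow (by positivity) dist_nonneg
    · push Not at hne
      have h1 : a = a' := funext fun n => (hne n).1
      have h2 : b = b' := funext fun n => (hne n).2
      have : z = z' := Prod.ext (by rw [← hz1, ← hz1', h1]) (by rw [← hz2, ← hz2', h2])
      rw [this, dist_self]
      positivity
  have hsub : P '' S ⊆ specificationParameters ∩ piece (q + 4) := by
    rintro _ ⟨z, -, rfl⟩
    set a := Real.digits z.1 q with ha
    set b := Real.digits z.2 q with hb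
    have h0 : P z 0 = A a b := by simp [P, ha, hb]
    have h1 : P z 1 = B a b := by simp [P, ha, hb]
    have hpar : P z ∈ parameters := by
      refine ⟨by rw [h0]; exact hA a b, ?_⟩
      rw [h1, mem_Ioi]
      linarith [(hB a b).1]
    refine ⟨⟨hpar, ?_⟩, hpar, ?_⟩
    · rw [h0, h1]
      refine hasSpecification_of_isExpansion (hA a b) (by linarith [(hB a b).1])
        (δ := 1 / (q + 4)) (by positivity) ?_ (hx a b) (hy a b) (hx0 a b) (hy0 a b) (hxm a b)
        (hym a b)
      rw [div_le_one (by positivity)]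
      linarith
    -- The point `y 1 = α + β - (q + 4)` lies strictly between `0` and `1`.
    · have h := hy a b 0
      have h' := hym a b 0
      have hpos : 0 < 1 / ((q : ℝ) + 4) := by positivity
      rw [hy0] at h
      simp only [shiftedDigits] at h
      rw [h0, h1]
      push_cast at h ⊢
      exact ⟨by linarith [h'.1], by linarith [h'.2]⟩
  have hdS : dimH S = 2 := by
    have : (interior S).Nonempty := by
      rw [hS, interior_prod_eq, interior_Ico]
      exact ⟨(1 / 2, 1 / 2), by norm_num⟩
    rw [Real.dimH_of_nonempty_interior this]
    simp
  have h := dimH_le_of_dist_le hr hdist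
  rw [hdS, ENNReal.le_div_iff_mul_le (Or.inl (by simpa using hr.ne')) (Or.inl (by simp))] at h
  refine le_trans (le_of_eq ?_) (h.trans (dimH_mono hsub))
  rw [ENNReal.ofReal_mul (by norm_num)]
  congr 1
  · simp
  · exact ENNReal.ofReal_coe_nnreal (p := r)

theorem dimH_plane_le (s : Set (EuclideanSpace ℝ (Fin 2))) : dimH s ≤ 2 := by
  refine (dimH_mono (subset_univ s)).trans ?_
  rw [Real.dimH_univ_eq_finrank]
  simp

theorem tendsto_dimH_piece :
    Tendsto (fun l : ℕ => dimH (specificationParameters ∩ piece l)) atTop (𝓝 2) := by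
  rw [← tendsto_add_atTop_iff_nat 4]
  have hlim : Tendsto (fun q : ℕ => ENNReal.ofReal (2 * (1 - Real.log 6 / Real.log (q + 5))))
      atTop (𝓝 2) := by
    have h1 : Tendsto (fun q : ℕ => Real.log ((q : ℝ) + 5)) atTop atTop :=
      Real.tendsto_log_atTop.comp
        (tendsto_atTop_add_const_right _ _ tendsto_natCast_atTop_atTop)
    have h2 := ENNReal.tendsto_ofReal
      (((h1.const_div_atTop (Real.log 6)).const_sub 1).const_mul 2)
    simpa using h2
  refine tendsto_of_tendsto_of_tendsto_of_le_of_le' hlim tendsto_const_nhds ?_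
    (Eventually.of_forall fun _ => dimH_plane_le _)
  filter_upwards [eventually_ge_atTop 2] with q hq
  refine le_trans (ENNReal.ofReal_le_ofReal ?_) (le_dimH_piece hq)
  have hq2 : (2 : ℝ) ≤ q := by exact_mod_cast hq
  have hlogB : 0 < Real.log (q + 5) := Real.log_pos (by linarith)
  -- From `q + 5 ≤ 6q`.
  have h : Real.log (q + 5) ≤ Real.log 6 + Real.log q := by
    rw [← Real.log_mul (by norm_num) (by linarith)]
    exact Real.log_le_log (by linarith) (by linarith)
  rw [one_sub_div hlogB.ne']
  gcongr
  linarith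

end ABShift

theorem theorem1p1 :
    dimH ABShift.specificationParameters = 2 ∧
      Tendsto (fun l : ℕ => dimH (ABShift.specificationParameters ∩ ABShift.piece l))
        atTop (𝓝 2) :=
  ⟨(ABShift.dimH_plane_le _).antisymm (le_of_tendsto ABShift.tendsto_dimH_piece
    (Eventually.of_forall fun _ => dimH_mono inter_subset_left)), ABShift.tendsto_dimH_piece⟩
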